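/- Let $G$ be a finite-dimensional real Lie group with Lie algebra $\mathfrak g$, and let $G=NH$, where $N$ and $H$ are closed (embedded) Lie subgroups of $G$, $H$ is connected, and $N$ is normal and exponential solvable (its Lie algebra is solvable and its exponential map is a diffeomorphism from its Lie algebra onto $N$). Let $\mathfrak n$ and $\mathfrak h$ be the Lie algebras of $N$ and $H$, viewed as subspaces of $\mathfrak g$; assume that $\mathfrak n$ is an ideal, $\mathfrak g=\mathfrak n\oplus\mathfrak h$, and $n=\dim\mathfrak n\ge r=\dim\mathfrak h$. Fix bases $X_1,\dots,X_n$ of $\mathfrak n$ and $A_1,\dots,A_r$ of $\mathfrak h$. For $\omega\in\mathfrak n^*$ define $$\beta_\omega:H\to\mathfrak n^*,\qquad \beta_\omega(h)=\mathrm{Ad}(h^{-1})^*\omega=\omega\circ \mathrm{Ad}(h^{-1})|_{\mathfrak n},$$ where $\mathrm{Ad}(g)$ is the differential of $y\mapsto gyg^{-1}$ at the identity of $G$, and let $D(\omega)$ be the $n\times r$ matrix $D(\omega)=\big(\langle\omega,[X_j,A_k]\rangle\big)_{1\le j\le n,\,1\le k\le r}$. We say that $\beta_\omega$ is an immersion at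 the identity $e$ of $H$ if it is smooth near $e$ and its differential at $e$ is injective. Then: 1. For every $\omega\in\mathfrak n^*$, $D(\omega)$ is the Jacobian matrix of $\beta_\omega$ at $e$, with respect to the basis $(A_k)$ of $\mathfrak h$ (the tangent space of $H$ at $e$) and the basis of $\mathfrak n^*$ dual to $(X_j)$. 2. The function $\omega\mapsto\det\big(D(\omega)^{T}D(\omega)\big)$ is a polynomial function on $\mathfrak n^*$, and $$\{\omega\in\mathfrak n^*:\beta_\omega\text{ is an immersion at }e\}=\{\omega\in\mathfrak n^*:\det\big(D(\omega)^{T}D(\omega)\big)\neq0\}.$$ 3. In particular, the set of $\omega\in\mathfrak n^*$ for which $\beta_\omega$ is an immersion at $e$ is a Zariski open subset of $\mathfrak n^*$ (the complement of the common zero set of a family of polynomial functions). -/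

import Mathlib

open scoped Manifold ContDiff

noncomputable section

namespace CoadjointImmersion

section LieGroups

variable {E : Type*} [NormedAddCommGroup E] [NormedSpace ℝ E]
  {G : Type*} [TopologicalSpace G] [ChartedSpace E G] [Group G]

instance instLieGroupMinSmoothness [LieGroup 𝓘(ℝ, E) ∞ G] :
    LieGroup 𝓘(ℝ, E) (minSmoothness ℝ 3) G :=
  LieGroup.of_le (n := ∞) (by
    rw [minSmoothness_of_isRCLikeNormedField]
    exact ENat.LEInfty.out)

variable (E) in
/-- The adjoint action `Ad g` on the Lie algebra of `G`: the differential of `y ↦ g y g⁻¹` at the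
neutral element. -/
def Ad (g : G) : GroupLieAlgebra 𝓘(ℝ, E) G →L[ℝ] GroupLieAlgebra 𝓘(ℝ, E) G :=
  mfderiv 𝓘(ℝ, E) 𝓘(ℝ, E) (fun y : G => g * y * g⁻¹) (1 : G)

/-- The differential at the neutral element of the inclusion `S → G` of a Lie subgroup. -/
def inclusionDeriv (E : Type*) [NormedAddCommGroup E] [NormedSpace ℝ E]
    {G : Type*} [TopologicalSpace G] [ChartedSpace E G] [Group G]
    (E' : Type*) [NormedAddCommGroup E'] [NormedSpace ℝ E']
    (S : Subgroup G) [ChartedSpace E' S] :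
    GroupLieAlgebra 𝓘(ℝ, E') S →L[ℝ] GroupLieAlgebra 𝓘(ℝ, E) G :=
  mfderiv 𝓘(ℝ, E') 𝓘(ℝ, E) (fun x : S => (x : G)) (1 : S)

/-- The Lie algebra of a Lie subgroup `S` of `G`, as a linear subspace of the Lie algebra of `G`:
the tangent space of `S` at the neutral element. -/
def subgroupLieAlgebra (E : Type*) [NormedAddCommGroup E] [NormedSpace ℝ E]
    {G : Type*} [TopologicalSpace G] [ChartedSpace E G] [Group G]
    (E' : Type*) [NormedAddCommGroup E'] [NormedSpace ℝ E']
    (S : Subgroup G) [ChartedSpace E' S] : Submodule ℝ (GroupLieAlgebra 𝓘(ℝ, E) G) :=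
  LinearMap.range (inclusionDeriv E E' S).toLinearMap

/-- `e` is the exponential map of the Lie group `G`: for every `X`, the curve `t ↦ e (t X)` is
a one-parameter subgroup with velocity `X` at `t = 0`. -/
def IsLieExp (e : GroupLieAlgebra 𝓘(ℝ, E) G → G) : Prop :=
  ∀ X : GroupLieAlgebra 𝓘(ℝ, E) G,
    (∀ s t : ℝ, e ((s + t) • X) = e (s • X) * e (t • X)) ∧
    MDifferentiableAt 𝓘(ℝ, ℝ) 𝓘(ℝ, E) (fun t : ℝ => e (t • X)) 0 ∧
    mfderiv 𝓘(ℝ, ℝ) 𝓘(ℝ, E) (fun t : ℝ => e (t • X)) 0 (1 : ℝ) = X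

variable (E G) in
/-- `G` is an exponential Lie group: its exponential map is a diffeomorphism from the Lie algebra
onto `G`. (The tangent space at the neutral element is the model space `E`.) -/
def IsExponential : Prop :=
  ∃ e : Diffeomorph 𝓘(ℝ, E) 𝓘(ℝ, E) E G ∞, IsLieExp (E := E) (G := G) e

end LieGroups

section Setting

variable {E EN EH : Type*} [NormedAddCommGroup E] [NormedSpace ℝ E]
  [NormedAddCommGroup EN] [NormedSpace ℝ EN] [NormedAddCommGroup EH] [NormedSpace ℝ EH]
  {G : Type*} [TopologicalSpace G] [ChartedSpace E G] [Group G]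

/-- The standing assumptions: `G = NH` for closed Lie subgroups `N`, `H`, with `H` connected and
`N` normal and exponential solvable; the Lie algebra `𝔫` of `N` is an ideal of the Lie algebra `𝔤`
of `G`, which is the direct sum of `𝔫` and the Lie algebra `𝔥` of `H`; and `dim 𝔥 ≤ dim 𝔫`. -/
structure StandingAssumptions [CompleteSpace E] [LieGroup 𝓘(ℝ, E) ∞ G]
    (N H : Subgroup G) [ChartedSpace EN N] [ChartedSpace EH H]
    (𝔫 : LieIdeal ℝ (GroupLieAlgebra 𝓘(ℝ, E) G)) : Prop where
  normal : N.Normal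
  isClosed_N : IsClosed (N : Set G)
  isClosed_H : IsClosed (H : Set G)
  embedded_N : Manifold.IsSmoothEmbedding 𝓘(ℝ, EN) 𝓘(ℝ, E) ∞ (fun x : N => (x : G))
  embedded_H : Manifold.IsSmoothEmbedding 𝓘(ℝ, EH) 𝓘(ℝ, E) ∞ (fun x : H => (x : G))
  connected_H : IsConnected (H : Set G)
  exponential_N : IsExponential EN N
  solvable_N : LieAlgebra.IsSolvable 𝔫
  eq_mul : ∀ g : G, ∃ x ∈ N, ∃ h ∈ H, g = x * h
  lieAlgebra_N : 𝔫.toSubmodule = subgroupLieAlgebra E EN N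
  isCompl : IsCompl 𝔫.toSubmodule (subgroupLieAlgebra E EH H)
  finrank_le : Module.finrank ℝ (subgroupLieAlgebra E EH H) ≤ Module.finrank ℝ 𝔫

/-- The adjoint action of `G` preserves the Lie algebra of a normal Lie subgroup. -/
theorem Ad_mem_subgroupLieAlgebra [LieGroup 𝓘(ℝ, E) ∞ G]
    (N : Subgroup G) [ChartedSpace EN N] (hnormal : N.Normal)
    (hN : Manifold.IsSmoothEmbedding 𝓘(ℝ, EN) 𝓘(ℝ, E) ∞ (fun x : N => (x : G)))
    (g : G) {X : GroupLieAlgebra 𝓘(ℝ, E) G} (hX : X ∈ subgroupLieAlgebra E EN N) :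
    Ad E g X ∈ subgroupLieAlgebra E EN N := by
  obtain ⟨Y, rfl⟩ := hX
  have hmem : ∀ x : N, g * (x : G) * g⁻¹ ∈ N := fun x => hnormal.conj_mem x x.2 g
  let c : N → N := fun x => ⟨g * (x : G) * g⁻¹, hmem x⟩
  have hc1 : c 1 = 1 := Subtype.ext (by simp [c])
  have hι : ContMDiff 𝓘(ℝ, EN) 𝓘(ℝ, E) ∞ (fun x : N => (x : G)) := hN.contMDiff
  have hconj : ContMDiff 𝓘(ℝ, E) 𝓘(ℝ, E) ∞ (fun y : G => g * y * g⁻¹) :=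
    (contMDiff_const.mul contMDiff_id).mul contMDiff_const
  have hcomp : ContMDiff 𝓘(ℝ, EN) 𝓘(ℝ, E) ∞ (fun x : N => g * (x : G) * g⁻¹) := hconj.comp hι
  have hcont : Continuous c := hcomp.continuous.subtype_mk _
  have hc : ContMDiffAt 𝓘(ℝ, EN) 𝓘(ℝ, EN) ∞ c 1 :=
    (ContMDiffAt.iff_comp_isImmersionAt (hN.isImmersion.isImmersionAt (c 1))).2
      ⟨hcont.continuousAt, hcomp.contMDiffAt⟩
  have hdc : MDifferentiableAt 𝓘(ℝ, EN) 𝓘(ℝ, EN) c 1 := hc.mdifferentiableAt (by simp)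
  have hdι : ∀ x : N, MDifferentiableAt 𝓘(ℝ, EN) 𝓘(ℝ, E) (fun x : N => (x : G)) x :=
    fun x => hι.contMDiffAt.mdifferentiableAt (by simp)
  have hdg : MDifferentiableAt 𝓘(ℝ, E) 𝓘(ℝ, E) (fun y : G => g * y * g⁻¹) ((1 : N) : G) :=
    hconj.contMDiffAt.mdifferentiableAt (by simp)
  have h1 := mfderiv_comp (1 : N) hdg (hdι 1)
  have h2 := mfderiv_comp (1 : N) (hdι (c 1)) hdc
  have h3 : (fun y : G => g * y * g⁻¹) ∘ (fun x : N => (x : G)) =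
      (fun x : N => (x : G)) ∘ c := rfl
  rw [h3, h2] at h1
  have h4 := congrArg (fun L => L Y) h1
  rw [hc1] at h4
  exact ⟨mfderiv 𝓘(ℝ, EN) 𝓘(ℝ, EN) c 1 Y, h4⟩

variable [CompleteSpace E] [LieGroup 𝓘(ℝ, E) ∞ G]
  {N H : Subgroup G} [ChartedSpace EN N] [ChartedSpace EH H]
  {𝔫 : LieIdeal ℝ (GroupLieAlgebra 𝓘(ℝ, E) G)}

theorem StandingAssumptions.Ad_mem (S : StandingAssumptions (EN := EN) (EH := EH) N H 𝔫) (g : G) :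
    ∀ X ∈ 𝔫.toSubmodule, (Ad E g).toLinearMap X ∈ 𝔫.toSubmodule := by
  intro X hX
  rw [S.lieAlgebra_N] at hX ⊢
  exact Ad_mem_subgroupLieAlgebra N S.normal S.embedded_N g hX

/-- The transpose `Ad(g)^* : 𝔫^* → 𝔫^*` of the restriction of `Ad g` to `𝔫`. -/
def AdDual (S : StandingAssumptions (EN := EN) (EH := EH) N H 𝔫) (g : G) :
    Module.Dual ℝ 𝔫 →ₗ[ℝ] Module.Dual ℝ 𝔫 :=
  Module.Dual.transpose (((Ad E g).toLinearMap).restrict (S.Ad_mem g))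

/-- The map `β_ξ : H → 𝔫^*`, `β_ξ(h) = Ad(h⁻¹)^* ξ`. -/
def beta (S : StandingAssumptions (EN := EN) (EH := EH) N H 𝔫) (ξ : Module.Dual ℝ 𝔫) (h : H) :
    Module.Dual ℝ 𝔫 :=
  AdDual S ((h⁻¹ : H) : G) ξ

/-- The matrix `D(ξ)` whose `(j, k)` entry is `⟨ξ, [X_j, A_k]⟩`, for a basis `X` of `𝔫` and a basis
`A` of `𝔥`. -/
def D {𝔥 : Submodule ℝ (GroupLieAlgebra 𝓘(ℝ, E) G)} {n r : ℕ}
    (X : Module.Basis (Fin n) ℝ 𝔫) (A : Module.Basis (Fin r) ℝ 𝔥) (ξ : Module.Dual ℝ 𝔫) :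
    Matrix (Fin n) (Fin r) ℝ :=
  Matrix.of fun j k => ξ ⟨⁅(X j : GroupLieAlgebra 𝓘(ℝ, E) G), (A k : GroupLieAlgebra 𝓘(ℝ, E) G)⁆,
    lie_mem_left ℝ (GroupLieAlgebra 𝓘(ℝ, E) G) 𝔫 _ _ (X j).2⟩

end Setting

section Immersion

variable {E : Type*} [NormedAddCommGroup E] [NormedSpace ℝ E]
  {M : Type*} [TopologicalSpace M] [ChartedSpace E M]
  {V : Type*} [AddCommGroup V] [Module ℝ V] {n : ℕ}

/-- A map `f : M → V^*` to the dual of a vector space, written in the linear coordinates of `V^*`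
given by the basis dual to a basis `X` of `V`; that is, `p ↦ (⟨f p, X_j⟩)_j`. -/
def inDualCoords (X : Module.Basis (Fin n) ℝ V) (f : M → Module.Dual ℝ V) (p : M) : Fin n → ℝ :=
  X.dualBasis.equivFun (f p)

/-- A map `f` from a manifold to the dual of a finite-dimensional vector space is an immersion at
`p` if it is smooth near `p` and its differential at `p` is injective. The smooth structure of the
dual is the one given by linear coordinates, here those of the basis dual to `X`. -/
def IsImmersionAtPoint (X : Module.Basis (Fin n) ℝ V) (f : M → Module.Dual ℝ V) (p : M) : Prop :=
  ContMDiffAt 𝓘(ℝ, E) 𝓘(ℝ, Fin n → ℝ) ∞ (inDualCoords X f) p ∧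
  Function.Injective (mfderiv 𝓘(ℝ, E) 𝓘(ℝ, Fin n → ℝ) (inDualCoords X f) p)

end Immersion

section Zariski

variable {V : Type*} [AddCommGroup V] [Module ℝ V]

/-- A real-valued function on a vector space is polynomial if it belongs to the algebra of
functions generated by the linear functionals. -/
def IsPolynomialFunction (f : V → ℝ) : Prop :=
  f ∈ Algebra.adjoin ℝ (Set.range fun φ : Module.Dual ℝ V => (φ : V → ℝ))

/-- Zariski open sets: complements of common zero sets of families of polynomial functions. -/
def IsZariskiOpen (U : Set V) : Prop :=
  ∃ F : Set (V → ℝ), (∀ f ∈ F, IsPolynomialFunction f) ∧ U = {v | ∀ f ∈ F, f v = 0}ᶜ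

end Zariski

end CoadjointImmersion

end

/-! Everything rests on the identity d/dh Ad(h⁻¹)X at e in direction A = [X, A]. Work in the
preferred chart at 1, with coordinate e of the identity, m the product and c(x, y) = x⁻¹yx.
Differentiating m(x, c(x, y)) = m(y, x) in y at e gives L(x) ∘ K(x) = R(x), where K(x) is Ad(x⁻¹),
and L(x), R(x) are the differentials of left and right translation by x. Differentiating again in x
at e, where L = K = id, gives DK(v)w = DR(v)w - DL(v)w, and symmetry of second derivatives turns
DR(v)w into DL(w)v (`fderiv_conj_eq`). The left-invariant field of X is x ↦ L(x)X, so the same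
antisymmetrization is the Lie bracket (`bracket_eq_fderiv`).

The j-th dual coordinate of β_ξ is h ↦ ℓ(Ad(h⁻¹)X_j), with ℓ extending ξ to 𝔤. The chain rule along
H → G therefore makes D(ξ) the Jacobian. The differential of H → G is injective with range 𝔥, so β_ξ
is an immersion at e iff D(ξ) has independent columns, i.e. iff its Gram determinant is nonzero. The
entries of D(ξ) are linear in ξ, so that determinant is polynomial. -/

open scoped Topology

noncomputable section

namespace CoadjointImmersion

/-! ### Mixed second derivatives and the local conjugation formula -/

section TwoVariables

variable {E : Type*} [NormedAddCommGroup E] [NormedSpace ℝ E]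

/-- Partial derivative of a function of two variables as a restriction of the total derivative. -/
theorem fderiv_partial_right {m : E × E → E} {x y : E} (hm : DifferentiableAt ℝ m (x, y)) :
    fderiv ℝ (fun z => m (x, z)) y = (fderiv ℝ m (x, y)).comp (ContinuousLinearMap.inr ℝ E E) := by
  have h : HasFDerivAt (fun z : E => (x, z)) (ContinuousLinearMap.inr ℝ E E) y :=
    (hasFDerivAt_const x y).prodMk (hasFDerivAt_id y)
  exact (hm.hasFDerivAt.comp y h).fderiv

theorem fderiv_partial_left {m : E × E → E} {x y : E} (hm : DifferentiableAt ℝ m (x, y)) :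
    fderiv ℝ (fun z => m (z, y)) x = (fderiv ℝ m (x, y)).comp (ContinuousLinearMap.inl ℝ E E) := by
  have h : HasFDerivAt (fun z : E => (z, y)) (ContinuousLinearMap.inl ℝ E E) x :=
    (hasFDerivAt_id x).prodMk (hasFDerivAt_const y x)
  exact (hm.hasFDerivAt.comp x h).fderiv

theorem contDiffAt_fderiv_partial_right {m : E × E → E} {e : E} (hm : ContDiffAt ℝ ∞ m (e, e)) :
    ContDiffAt ℝ ∞ (fun x => fderiv ℝ (fun y => m (x, y)) e) e :=
  ContDiffAt.fderiv (f := fun x y => m (x, y)) (g := fun _ => e) (n := ∞) hm contDiffAt_const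
    (by simp)

/-- The mixed second derivatives of a function of two variables agree. -/
theorem fderiv_fderiv_partial_comm {m : E × E → E} {e : E} (hm : ContDiffAt ℝ ∞ m (e, e))
    (v w : E) :
    fderiv ℝ (fun x => fderiv ℝ (fun y => m (y, x)) e) e v w =
      fderiv ℝ (fun x => fderiv ℝ (fun y => m (x, y)) e) e w v := by
  have hd : ∀ᶠ p in 𝓝 (e, e), DifferentiableAt ℝ m p :=
    ((hm.of_le (m := 1) (by simp)).eventually (by simp)).mono
      fun p hp => hp.differentiableAt (by simp)
  have hd2 : DifferentiableAt ℝ (fderiv ℝ m) (e, e) :=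
    (hm.fderiv_right (m := 1) (by norm_cast)).differentiableAt (by simp)
  have hl : HasFDerivAt (fun x : E => (x, e)) (ContinuousLinearMap.inl ℝ E E) e :=
    (hasFDerivAt_id e).prodMk (hasFDerivAt_const e e)
  have hr : HasFDerivAt (fun x : E => (e, x)) (ContinuousLinearMap.inr ℝ E E) e :=
    (hasFDerivAt_const e e).prodMk (hasFDerivAt_id e)
  have h1 : (fun x => fderiv ℝ (fun y => m (y, x)) e) =ᶠ[𝓝 e]
      fun x => (fderiv ℝ m (e, x)).comp (ContinuousLinearMap.inl ℝ E E) := by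
    filter_upwards [hr.continuousAt.eventually hd] with x hx using fderiv_partial_left hx
  have h2 : (fun x => fderiv ℝ (fun y => m (x, y)) e) =ᶠ[𝓝 e]
      fun x => (fderiv ℝ m (x, e)).comp (ContinuousLinearMap.inr ℝ E E) := by
    filter_upwards [hl.continuousAt.eventually hd] with x hx using fderiv_partial_right hx
  rw [h1.fderiv_eq, h2.fderiv_eq]
  have hl2 := ((HasFDerivAt.comp (f := fun x : E => (x, e)) e hd2.hasFDerivAt hl).clm_comp
    (hasFDerivAt_const (ContinuousLinearMap.inr ℝ E E) e)).fderiv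
  have hr2 := ((HasFDerivAt.comp (f := fun x : E => (e, x)) e hd2.hasFDerivAt hr).clm_comp
    (hasFDerivAt_const (ContinuousLinearMap.inl ℝ E E) e)).fderiv
  have hs : IsSymmSndFDerivAt ℝ m (e, e) :=
    hm.isSymmSndFDerivAt (by rw [minSmoothness_of_isRCLikeNormedField]; exact ENat.LEInfty.out)
  -- Testing symmetry on one vector from each factor isolates the mixed partial derivatives.
  have := hs (0, v) (w, 0)
  simp only [Function.comp_def] at hl2 hr2
  rw [hl2, hr2]
  simpa using this

/-- The derivative at the neutral element of the adjoint action of the inverse, for a group law `m`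
and conjugation `c (x, y) = x⁻¹ y x` given on an open subset of a vector space. -/
theorem fderiv_conj_eq {m c : E × E → E} {e : E} (hm : ContDiffAt ℝ ∞ m (e, e))
    (hc : ContDiffAt ℝ ∞ c (e, e)) (hmc : ∀ᶠ p in 𝓝 (e, e), m (p.1, c p) = m (p.2, p.1))
    (hce : ∀ᶠ x in 𝓝 e, c (x, e) = e) (hme : ∀ᶠ y in 𝓝 e, m (e, y) = y)
    (hem : ∀ᶠ y in 𝓝 e, c (e, y) = y) (v w : E) :
    fderiv ℝ (fun x => fderiv ℝ (fun y => c (x, y)) e) e v w =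
      fderiv ℝ (fun x => fderiv ℝ (fun y => m (x, y)) e) e w v -
      fderiv ℝ (fun x => fderiv ℝ (fun y => m (x, y)) e) e v w := by
  have hd : ∀ᶠ p in 𝓝 (e, e), DifferentiableAt ℝ m p :=
    ((hm.of_le (m := 1) (by simp)).eventually (by simp)).mono
      fun p hp => hp.differentiableAt (by simp)
  have hdc : ∀ᶠ p in 𝓝 (e, e), DifferentiableAt ℝ c p :=
    ((hc.of_le (m := 1) (by simp)).eventually (by simp)).mono
      fun p hp => hp.differentiableAt (by simp)
  have hcl : ContinuousAt (fun x : E => (x, e)) e := by fun_prop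
  -- The y-derivative at e of m(x, c(x, y)) = m(y, x). It needs the relation for all y near e at
  -- each fixed x, hence `eventually_nhds`.
  have key : (fun x => (fderiv ℝ (fun y => m (x, y)) e).comp (fderiv ℝ (fun y => c (x, y)) e))
      =ᶠ[𝓝 e] fun x => fderiv ℝ (fun y => m (y, x)) e := by
    filter_upwards [hcl.eventually hd, hcl.eventually hdc, hce, hcl.eventually hmc.eventually_nhds]
      with x h1 h2 h3 h4
    have hr : ContinuousAt (fun y : E => (x, y)) e := by fun_prop
    have h5 : (fun y => m (x, c (x, y))) =ᶠ[𝓝 e] fun y => m (y, x) := hr.eventually h4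
    rw [← h5.fderiv_eq]
    have d1 : DifferentiableAt ℝ (fun y => m (x, y)) (c (x, e)) := by
      rw [h3]; exact h1.comp e (by fun_prop)
    have d2 : DifferentiableAt ℝ (fun y => c (x, y)) e := h2.comp e (by fun_prop)
    have := fderiv_comp e d1 d2
    rw [h3] at this
    exact this.symm
  have hL := (contDiffAt_fderiv_partial_right hm).differentiableAt (by simp)
  have hK := (contDiffAt_fderiv_partial_right hc).differentiableAt (by simp)
  have h := (hL.hasFDerivAt.clm_comp hK.hasFDerivAt).fderiv
  rw [key.fderiv_eq] at h
  have hL1 : fderiv ℝ (fun y => m (e, y)) e = ContinuousLinearMap.id ℝ E := by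
    rw [Filter.EventuallyEq.fderiv_eq (f := id) hme, fderiv_id]
  have hK1 : fderiv ℝ (fun y => c (e, y)) e = ContinuousLinearMap.id ℝ E := by
    rw [Filter.EventuallyEq.fderiv_eq (f := id) hem, fderiv_id]
  rw [hL1, hK1] at h
  have h' := congrArg (fun T => T v w) h
  -- Right translation is traded for left translation, at the price of swapping v and w.
  simp only [fderiv_fderiv_partial_comm hm v w] at h'
  rw [h']
  simp

end TwoVariables

/-! ### Auxiliary facts: immersions, brackets in charts, polynomial functions, Gram matrices -/

/-- The differential of an immersion is injective. -/
theorem _root_.Manifold.IsImmersionAt.mfderiv_injective {E E' : Type*}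
    [NormedAddCommGroup E] [NormedSpace ℝ E] [NormedAddCommGroup E'] [NormedSpace ℝ E']
    {M M' : Type*} [TopologicalSpace M] [ChartedSpace E M] [TopologicalSpace M']
    [ChartedSpace E' M'] {f : M → M'} {x : M}
    (h : Manifold.IsImmersionAt 𝓘(ℝ, E) 𝓘(ℝ, E') ∞ f x) (hf : MDifferentiableAt 𝓘(ℝ, E) 𝓘(ℝ, E') f x)
    [IsManifold 𝓘(ℝ, E) ∞ M] [IsManifold 𝓘(ℝ, E') ∞ M'] :
    Function.Injective (mfderiv 𝓘(ℝ, E) 𝓘(ℝ, E') f x) := by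
  have hx := h.mem_domChart_source
  have hd : MDifferentiableAt 𝓘(ℝ, E) 𝓘(ℝ, E) h.domChart x :=
    (contMDiffAt_of_mem_maximalAtlas h.domChart_mem_maximalAtlas hx).mdifferentiableAt (by simp)
  have hd' : MDifferentiableAt 𝓘(ℝ, E) 𝓘(ℝ, E) h.domChart.symm (h.domChart x) :=
    (contMDiffAt_symm_of_mem_maximalAtlas h.domChart_mem_maximalAtlas
      (h.domChart.map_source hx)).mdifferentiableAt (by simp)
  have hc : MDifferentiableAt 𝓘(ℝ, E') 𝓘(ℝ, E') h.codChart (f x) :=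
    (contMDiffAt_of_mem_maximalAtlas h.codChart_mem_maximalAtlas
      h.mem_codChart_source).mdifferentiableAt (by simp)
  -- In adapted charts f is u ↦ (u, 0), so projecting to the first factor yields a differentiable
  -- local left inverse of f.
  let π : E' →L[ℝ] E := (ContinuousLinearMap.fst ℝ E h.complement).comp
    (h.equiv.symm : E' →L[ℝ] E × h.complement)
  have hπ : ∀ᶠ y in 𝓝 x, π (h.codChart (f y)) = h.domChart y := by
    filter_upwards [h.domChart.open_source.mem_nhds hx] with y hy
    have hmem : h.domChart y ∈ (h.domChart.extend 𝓘(ℝ, E)).target := by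
      simpa [OpenPartialHomeomorph.extend] using h.domChart.map_source hy
    have := h.writtenInCharts hmem
    simp only [Function.comp_apply, mfld_simps, h.domChart.left_inv hy] at this
    simp [π, this]
  have hu : MDifferentiableAt 𝓘(ℝ, E') 𝓘(ℝ, E)
      (h.domChart.symm ∘ π ∘ h.codChart) (f x) := by
    refine MDifferentiableAt.comp (I' := 𝓘(ℝ, E)) _ ?_
      (π.differentiableAt.mdifferentiableAt.comp _ hc)
    simpa [hπ.self_of_nhds] using hd'
  have key : (h.domChart.symm ∘ π ∘ h.codChart) ∘ f =ᶠ[𝓝 x] id := by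
    filter_upwards [hπ, h.domChart.open_source.mem_nhds hx] with y hy hy'
    simp [hy, h.domChart.left_inv hy']
  have h1 := mfderiv_comp x hu hf
  rw [key.mfderiv_eq, mfderiv_id] at h1
  intro v w hvw
  have hv := congrArg (fun T => T v) h1
  have hw := congrArg (fun T => T w) h1
  simp only [ContinuousLinearMap.comp_apply] at hv hw
  rw [hvw] at hv
  exact hv.trans hw.symm

theorem mfderiv_eq_fderiv_extChartAt {E V : Type*}
    [NormedAddCommGroup E] [NormedSpace ℝ E] [NormedAddCommGroup V] [NormedSpace ℝ V]
    {M : Type*} [TopologicalSpace M] [ChartedSpace E M] {f : M → V} {x : M}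
    (hf : MDifferentiableAt 𝓘(ℝ, E) 𝓘(ℝ, V) f x) :
    mfderiv 𝓘(ℝ, E) 𝓘(ℝ, V) f x =
      fderiv ℝ (fun y => f ((extChartAt 𝓘(ℝ, E) x).symm y)) (extChartAt 𝓘(ℝ, E) x x) := by
  refine hf.mfderiv.trans ?_
  simp only [writtenInExtChartAt, Function.comp_def, ModelWithCorners.range_eq_univ,
    fderivWithin_univ, extChartAt_model_space_eq_id, PartialEquiv.refl_coe, id_eq]
  rfl

theorem fderiv_clm_apply_const {E F V : Type*} [NormedAddCommGroup E] [NormedSpace ℝ E]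
    [NormedAddCommGroup F] [NormedSpace ℝ F] [NormedAddCommGroup V] [NormedSpace ℝ V]
    {K : E → F →L[ℝ] V} {e : E} (hK : DifferentiableAt ℝ K e) (w : F) :
    fderiv ℝ (fun x => K x w) e = (fderiv ℝ K e).flip w := by
  have h := (hK.hasFDerivAt.clm_apply (hasFDerivAt_const w e)).fderiv
  rwa [ContinuousLinearMap.comp_zero, zero_add] at h

/-- Intended for left-invariant fields in a chart, which are known only near e; the bracket depends
only on germs. The set `s` is kept general to match the one produced by unfolding the manifold
bracket. -/
theorem lieBracketWithin_eq_of_eventuallyEq_clm_apply {E : Type*} [NormedAddCommGroup E]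
    [NormedSpace ℝ E] {L : E → E →L[ℝ] E} {e : E} (hL : DifferentiableAt ℝ L e)
    (hLe : L e = ContinuousLinearMap.id ℝ E) {v w : E} {V W : E → E}
    (hV : V =ᶠ[𝓝 e] fun x => L x v) (hW : W =ᶠ[𝓝 e] fun x => L x w) {s : Set E}
    (hs : s = Set.univ) :
    VectorField.lieBracketWithin ℝ V W s e = fderiv ℝ L e v w - fderiv ℝ L e w v := by
  rw [hs, VectorField.lieBracketWithin_univ, hV.lieBracket_vectorField_eq hW,
    VectorField.lieBracket, fderiv_clm_apply_const hL, fderiv_clm_apply_const hL, hLe]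
  rfl

theorem isPolynomialFunction_dual {V : Type*} [AddCommGroup V] [Module ℝ V]
    (φ : Module.Dual ℝ V) : IsPolynomialFunction (fun v => φ v) :=
  Algebra.subset_adjoin ⟨φ, rfl⟩

theorem isPolynomialFunction_det {V ι : Type*} [AddCommGroup V] [Module ℝ V] [Fintype ι]
    [DecidableEq ι] {M : V → Matrix ι ι ℝ} (h : ∀ i j, IsPolynomialFunction fun v => M v i j) :
    IsPolynomialFunction fun v => (M v).det := by
  have : (fun v => (M v).det) =
      (Matrix.of fun i j => (fun v => M v i j : V → ℝ)).det := by
    ext v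
    simp [Matrix.det_apply, Finset.sum_apply, Finset.prod_apply]
  rw [this, Matrix.det_apply]
  unfold IsPolynomialFunction at *
  refine sum_mem fun σ _ => ?_
  rw [Units.smul_def]
  exact zsmul_mem (prod_mem fun i _ => h _ _) _

/-- A real matrix `B` has linearly independent columns if and only if its Gram matrix is
nonsingular. -/
theorem injective_mulVec_iff_det_transpose_mul_self_ne_zero {m n : Type*} [Fintype m] [Fintype n]
    [DecidableEq n] (B : Matrix m n ℝ) :
    Function.Injective B.mulVec ↔ (B.transpose * B).det ≠ 0 := by
  -- For the square Gram matrix, nonsingular means injective; over ℝ it has the same kernel as B,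
  -- since |Bx|² = xᵀBᵀBx.
  rw [← isUnit_iff_ne_zero, ← Matrix.isUnit_iff_isUnit_det,
    ← Matrix.mulVec_injective_iff_isUnit]
  rw [← Matrix.coe_mulVecLin, ← Matrix.coe_mulVecLin, ← LinearMap.ker_eq_bot,
    ← LinearMap.ker_eq_bot, Matrix.ker_mulVecLin_transpose_mul_self]

/-! ### Adjoint action and Lie bracket in the chart at the identity -/

section Chart

variable {E : Type*} [NormedAddCommGroup E] [NormedSpace ℝ E]
  {G : Type*} [TopologicalSpace G] [ChartedSpace E G] [Group G]

variable (E G) in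
/-- The multiplication of a Lie group in the preferred chart at the neutral element. -/
def chartMul (p : E × E) : E :=
  extChartAt 𝓘(ℝ, E) (1 : G)
    ((extChartAt 𝓘(ℝ, E) (1 : G)).symm p.1 * (extChartAt 𝓘(ℝ, E) (1 : G)).symm p.2)

variable (E G) in
/-- The map `(x, y) ↦ x⁻¹ y x` in the preferred chart at the neutral element. -/
def chartConj (p : E × E) : E :=
  extChartAt 𝓘(ℝ, E) (1 : G)
    (((extChartAt 𝓘(ℝ, E) (1 : G)).symm p.1)⁻¹ * (extChartAt 𝓘(ℝ, E) (1 : G)).symm p.2 *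
      (extChartAt 𝓘(ℝ, E) (1 : G)).symm p.1)

variable (E G) in
/-- The coordinates of the neutral element. -/
def chartOne : E := extChartAt 𝓘(ℝ, E) (1 : G) 1

@[simp]
theorem chartAt_symm_chartOne : (chartAt E (1 : G)).symm (chartOne E G) = 1 :=
  extChartAt_to_inv (I := 𝓘(ℝ, E)) 1

@[simp]
theorem chartAt_one_eq_chartOne : chartAt E (1 : G) 1 = chartOne E G := rfl

theorem eventually_right_inv_extChartAt :
    ∀ᶠ y in 𝓝 (chartOne E G), extChartAt 𝓘(ℝ, E) (1 : G) ((extChartAt 𝓘(ℝ, E) (1 : G)).symm y) = y := by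
  filter_upwards [extChartAt_target_mem_nhds (I := 𝓘(ℝ, E)) (1 : G)] with y hy
  exact (extChartAt 𝓘(ℝ, E) (1 : G)).right_inv hy

variable [LieGroup 𝓘(ℝ, E) ∞ G]

omit [Group G] [LieGroup 𝓘(ℝ, E) ∞ G] in
theorem contMDiffAt_extChartAt_symm [IsManifold 𝓘(ℝ, E) ∞ G] (g : G) :
    ContMDiffAt 𝓘(ℝ, E) 𝓘(ℝ, E) ∞ (extChartAt 𝓘(ℝ, E) g).symm (extChartAt 𝓘(ℝ, E) g g) :=
  (contMDiffOn_extChartAt_symm g).contMDiffAt (extChartAt_target_mem_nhds g)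

theorem contMDiffAt_symm_fst :
    ContMDiffAt 𝓘(ℝ, E × E) 𝓘(ℝ, E) ∞ (fun p : E × E => (extChartAt 𝓘(ℝ, E) (1 : G)).symm p.1)
      (chartOne E G, chartOne E G) :=
  (contMDiffAt_extChartAt_symm (1 : G)).comp (chartOne E G, chartOne E G)
    contDiffAt_fst.contMDiffAt

theorem contMDiffAt_symm_snd :
    ContMDiffAt 𝓘(ℝ, E × E) 𝓘(ℝ, E) ∞ (fun p : E × E => (extChartAt 𝓘(ℝ, E) (1 : G)).symm p.2)
      (chartOne E G, chartOne E G) :=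
  (contMDiffAt_extChartAt_symm (1 : G)).comp (chartOne E G, chartOne E G)
    contDiffAt_snd.contMDiffAt

theorem contDiffAt_chartMul : ContDiffAt ℝ ∞ (chartMul E G) (chartOne E G, chartOne E G) := by
  rw [← contMDiffAt_iff_contDiffAt]
  refine ContMDiffAt.comp_of_eq (I' := 𝓘(ℝ, E)) (contMDiffAt_extChartAt (x := (1 : G)))
    (contMDiffAt_symm_fst.mul contMDiffAt_symm_snd) (by simp)

theorem contMDiffAt_conj_symm :
    ContMDiffAt 𝓘(ℝ, E × E) 𝓘(ℝ, E) ∞ (fun p : E × E =>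
      ((extChartAt 𝓘(ℝ, E) (1 : G)).symm p.1)⁻¹ * (extChartAt 𝓘(ℝ, E) (1 : G)).symm p.2 *
        (extChartAt 𝓘(ℝ, E) (1 : G)).symm p.1) (chartOne E G, chartOne E G) :=
  (contMDiffAt_symm_fst.inv.mul contMDiffAt_symm_snd).mul contMDiffAt_symm_fst

theorem contDiffAt_chartConj : ContDiffAt ℝ ∞ (chartConj E G) (chartOne E G, chartOne E G) := by
  rw [← contMDiffAt_iff_contDiffAt]
  exact ContMDiffAt.comp_of_eq (I' := 𝓘(ℝ, E)) (contMDiffAt_extChartAt (x := (1 : G)))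
    contMDiffAt_conj_symm (by simp)

theorem fderiv_chartConj_eq (v w : E) :
    fderiv ℝ (fun x => fderiv ℝ (fun y => chartConj E G (x, y)) (chartOne E G)) (chartOne E G) v w =
      fderiv ℝ (fun x => fderiv ℝ (fun y => chartMul E G (x, y)) (chartOne E G)) (chartOne E G) w v -
      fderiv ℝ (fun x => fderiv ℝ (fun y => chartMul E G (x, y)) (chartOne E G)) (chartOne E G) v w := by
  refine fderiv_conj_eq contDiffAt_chartMul contDiffAt_chartConj ?_ ?_ ?_ ?_ v w
  -- Near (e, e) the conjugate stays in the chart domain, so reading it in coordinates and back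
  -- loses nothing.
  · have h := (contMDiffAt_conj_symm (E := E) (G := G)).continuousAt.eventually
      (p := fun g => g ∈ (extChartAt 𝓘(ℝ, E) (1 : G)).source)
      (by simpa using extChartAt_source_mem_nhds (I := 𝓘(ℝ, E)) (1 : G))
    filter_upwards [h] with p hp
    simp only [chartMul, chartConj]
    rw [(extChartAt 𝓘(ℝ, E) (1 : G)).left_inv hp]
    congr 1
    group
  · exact Filter.Eventually.of_forall fun x => by simp [chartConj]
  · filter_upwards [eventually_right_inv_extChartAt (E := E) (G := G)] with y hy
    simpa [chartMul] using hy
  · filter_upwards [eventually_right_inv_extChartAt (E := E) (G := G)] with y hy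
    simpa [chartConj] using hy

/-- The adjoint action of an inverse as a derivative in the preferred chart. -/
theorem Ad_inv_eq_fderiv (g : G) :
    Ad E g⁻¹ = fderiv ℝ (fun y => extChartAt 𝓘(ℝ, E) (1 : G)
      (g⁻¹ * (extChartAt 𝓘(ℝ, E) (1 : G)).symm y * g)) (chartOne E G) := by
  have hconj : ContMDiff 𝓘(ℝ, E) 𝓘(ℝ, E) ∞ (fun y : G => g⁻¹ * y * g⁻¹⁻¹) :=
    (contMDiff_const.mul contMDiff_id).mul contMDiff_const
  refine (hconj.contMDiffAt.mdifferentiableAt (by simp)).mfderiv.trans ?_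
  simp only [writtenInExtChartAt, Function.comp_def, ModelWithCorners.range_eq_univ,
    fderivWithin_univ, inv_inv, mul_one, inv_mul_cancel]
  rfl

/-- Pairing with ℓ gives a scalar function on G, whose smoothness and differential reduce to
calculus on `chartConj`. -/
theorem apply_Ad_inv_eventuallyEq (ℓ : E →L[ℝ] ℝ) (X : GroupLieAlgebra 𝓘(ℝ, E) G) :
    (fun g : G => ℓ (Ad E g⁻¹ X)) =ᶠ[𝓝 1]
      (fun x => ℓ (fderiv ℝ (fun y => chartConj E G (x, y)) (chartOne E G) X)) ∘
        extChartAt 𝓘(ℝ, E) (1 : G) := by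
  filter_upwards [extChartAt_source_mem_nhds (I := 𝓘(ℝ, E)) (1 : G)] with g hg
  simp only [Function.comp_apply, chartConj, (extChartAt 𝓘(ℝ, E) (1 : G)).left_inv hg]
  exact congrArg (fun T : E →L[ℝ] E => ℓ (T X)) (Ad_inv_eq_fderiv g)

theorem contMDiffAt_apply_Ad_inv (ℓ : E →L[ℝ] ℝ) (X : GroupLieAlgebra 𝓘(ℝ, E) G) :
    ContMDiffAt 𝓘(ℝ, E) 𝓘(ℝ, ℝ) ∞ (fun g : G => ℓ (Ad E g⁻¹ X)) 1 := by
  have h1 : ContDiffAt ℝ ∞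
      (fun x => ℓ (fderiv ℝ (fun y => chartConj E G (x, y)) (chartOne E G) X)) (chartOne E G) :=
    ℓ.contDiff.contDiffAt.comp _ ((contDiffAt_fderiv_partial_right
      (contDiffAt_chartConj (E := E) (G := G))).clm_apply contDiffAt_const)
  exact (ContMDiffAt.comp (1 : G) h1.contMDiffAt
    (contMDiffAt_extChartAt (I := 𝓘(ℝ, E)) (n := ∞) (x := (1 : G)))).congr_of_eventuallyEq
    (apply_Ad_inv_eventuallyEq ℓ X)

theorem mfderiv_apply_Ad_inv (ℓ : E →L[ℝ] ℝ) (X A : GroupLieAlgebra 𝓘(ℝ, E) G) :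
    mfderiv 𝓘(ℝ, E) 𝓘(ℝ, ℝ) (fun g : G => ℓ (Ad E g⁻¹ X)) 1 A =
      ℓ (fderiv ℝ (fun x => fderiv ℝ (fun y => chartConj E G (x, y)) (chartOne E G))
        (chartOne E G) A X) := by
  have hK := (contDiffAt_fderiv_partial_right
    (contDiffAt_chartConj (E := E) (G := G))).differentiableAt (by simp)
  rw [mfderiv_eq_fderiv_extChartAt ((contMDiffAt_apply_Ad_inv ℓ X).mdifferentiableAt (by simp))]
  have h : (fun y => ℓ (Ad E ((extChartAt 𝓘(ℝ, E) (1 : G)).symm y)⁻¹ X)) =ᶠ[𝓝 (chartOne E G)]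
      fun x => ℓ (fderiv ℝ (fun y => chartConj E G (x, y)) (chartOne E G) X) := by
    have hc : Filter.Tendsto (extChartAt 𝓘(ℝ, E) (1 : G)).symm (𝓝 (chartOne E G)) (𝓝 1) := by
      have := (contMDiffAt_extChartAt_symm (E := E) (1 : G)).continuousAt.tendsto
      rwa [extChartAt_to_inv] at this
    filter_upwards [hc.eventually (apply_Ad_inv_eventuallyEq ℓ X),
      eventually_right_inv_extChartAt (E := E) (G := G)] with y hy hy'
    rw [hy, Function.comp_apply, hy']
  have h2 : fderiv ℝ (fun x => ℓ (fderiv ℝ (fun y => chartConj E G (x, y)) (chartOne E G) X))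
      (chartOne E G) = ℓ.comp ((fderiv ℝ (fun x => fderiv ℝ (fun y => chartConj E G (x, y))
        (chartOne E G)) (chartOne E G)).flip X) := by
    rw [← fderiv_clm_apply_const hK X]
    exact (ℓ.hasFDerivAt.comp (chartOne E G)
      (hK.clm_apply (differentiableAt_const (X : E))).hasFDerivAt).fderiv
  exact congrArg (fun T : E →L[ℝ] ℝ => T A) (h.fderiv_eq.trans h2)

/-- A left-invariant vector field in the preferred chart at the neutral element. -/
theorem mpullback_mulInvariantVectorField_eventuallyEq (X : GroupLieAlgebra 𝓘(ℝ, E) G) :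
    VectorField.mpullbackWithin 𝓘(ℝ, E) 𝓘(ℝ, E) (extChartAt 𝓘(ℝ, E) (1 : G)).symm
      (mulInvariantVectorField X) (Set.range 𝓘(ℝ, E)) =ᶠ[𝓝 (chartOne E G)]
      fun x => fderiv ℝ (fun y => chartMul E G (x, y)) (chartOne E G) X := by
  filter_upwards [extChartAt_target_mem_nhds (I := 𝓘(ℝ, E)) (1 : G)] with x hx
  -- The pullback inverts the differential of the inverse chart; that inverse is the differential of
  -- the chart.
  have hinv := ContinuousLinearMap.inverse_eq
    (mfderivWithin_extChartAt_symm_comp_mfderiv_extChartAt hx)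
    (mfderiv_extChartAt_comp_mfderivWithin_extChartAt_symm hx)
  rw [VectorField.mpullbackWithin_apply, hinv, mulInvariantVectorField]
  set g := (extChartAt 𝓘(ℝ, E) (1 : G)).symm x with hg
  have hgs : g * 1 ∈ (chartAt E (1 : G)).source := by
    rw [mul_one, ← extChartAt_source 𝓘(ℝ, E)]
    exact (extChartAt 𝓘(ℝ, E) (1 : G)).map_target hx
  have d1 : MDifferentiableAt 𝓘(ℝ, E) 𝓘(ℝ, E) (extChartAt 𝓘(ℝ, E) (1 : G)) (g * 1) :=
    mdifferentiableAt_extChartAt hgs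
  have d2 : MDifferentiableAt 𝓘(ℝ, E) 𝓘(ℝ, E) (fun y : G => g * y) 1 :=
    (contMDiff_mul_left (n := ∞)).contMDiffAt.mdifferentiableAt (by simp)
  have h := mfderiv_comp (1 : G) d1 d2
  rw [mfderiv_eq_fderiv_extChartAt (d1.comp (1 : G) d2)] at h
  have h' := congrArg (fun T : E →L[ℝ] E => T X) h
  -- The chain rule for y ↦ gy at 1 leaves the base point as g * 1.
  have h1 : (mfderiv 𝓘(ℝ, E) 𝓘(ℝ, E) (extChartAt 𝓘(ℝ, E) (1 : G)) (g * 1) : E →L[ℝ] E) =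
      mfderiv 𝓘(ℝ, E) 𝓘(ℝ, E) (extChartAt 𝓘(ℝ, E) (1 : G)) g := by
    rw [mul_one]
  refine Eq.trans ?_ h'.symm
  exact congrArg (fun T : E →L[ℝ] E => T (mfderiv 𝓘(ℝ, E) 𝓘(ℝ, E) (fun y : G => g * y) 1 X))
    h1.symm

theorem bracket_eq_fderiv (X A : GroupLieAlgebra 𝓘(ℝ, E) G) :
    (⁅X, A⁆ : GroupLieAlgebra 𝓘(ℝ, E) G) =
      (fderiv ℝ (fun x => fderiv ℝ (fun y => chartMul E G (x, y)) (chartOne E G)) (chartOne E G) X A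
      - fderiv ℝ (fun x => fderiv ℝ (fun y => chartMul E G (x, y)) (chartOne E G))
        (chartOne E G) A X : E) := by
  have hL := (contDiffAt_fderiv_partial_right
    (contDiffAt_chartMul (E := E) (G := G))).differentiableAt (by simp)
  have hL1 : fderiv ℝ (fun y => chartMul E G (chartOne E G, y)) (chartOne E G) =
      ContinuousLinearMap.id ℝ E := by
    rw [Filter.EventuallyEq.fderiv_eq (f := id), fderiv_id]
    filter_upwards [eventually_right_inv_extChartAt (E := E) (G := G)] with y hy
    simpa [chartMul] using hy
  have hid : fderiv ℝ (fun y => extChartAt 𝓘(ℝ, E) (1 : G)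
      ((extChartAt 𝓘(ℝ, E) (1 : G)).symm y)) (chartOne E G) = ContinuousLinearMap.id ℝ E := by
    rw [Filter.EventuallyEq.fderiv_eq (f := id)
      (eventually_right_inv_extChartAt (E := E) (G := G)), fderiv_id]
  -- The manifold bracket is the chart bracket transported by this inverse, which is the identity
  -- because the preferred chart at 1 trivializes the tangent space there.
  have hone : (mfderiv 𝓘(ℝ, E) 𝓘(ℝ, E) (extChartAt 𝓘(ℝ, E) (1 : G)) 1 : E →L[ℝ] E).inverse =
      ContinuousLinearMap.id ℝ E :=
    (congrArg ContinuousLinearMap.inverse ((mfderiv_eq_fderiv_extChartAt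
      (mdifferentiableAt_extChartAt (mem_chart_source E (1 : G)))).trans hid)).trans
      ContinuousLinearMap.inverse_id
  have hset : (extChartAt 𝓘(ℝ, E) (1 : G)).symm ⁻¹' Set.univ ∩ Set.range 𝓘(ℝ, E) = Set.univ := by
    simp
  exact (ContinuousLinearMap.ext_iff.1 hone _).trans
    (lieBracketWithin_eq_of_eventuallyEq_clm_apply hL hL1
      (mpullback_mulInvariantVectorField_eventuallyEq X)
      (mpullback_mulInvariantVectorField_eventuallyEq A) hset)

/-- The adjoint action of inverses has differential `A ↦ [·, A]` at the neutral element. -/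
theorem mfderiv_apply_Ad_inv_eq_bracket (ℓ : E →L[ℝ] ℝ) (X A : GroupLieAlgebra 𝓘(ℝ, E) G) :
    mfderiv 𝓘(ℝ, E) 𝓘(ℝ, ℝ) (fun g : G => ℓ (Ad E g⁻¹ X)) 1 A =
      ℓ (⁅X, A⁆ : GroupLieAlgebra 𝓘(ℝ, E) G) := by
  refine (mfderiv_apply_Ad_inv ℓ X A).trans (congrArg ℓ ?_)
  exact (fderiv_chartConj_eq (E := E) (G := G) A X).trans (bracket_eq_fderiv X A).symm

end Chart

/-! ### The Jacobian of β_ξ and the immersion criterion -/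

section Beta

variable {E EN EH : Type*} [NormedAddCommGroup E] [NormedSpace ℝ E]
  [NormedAddCommGroup EN] [NormedSpace ℝ EN] [NormedAddCommGroup EH] [NormedSpace ℝ EH]
  {G : Type*} [TopologicalSpace G] [ChartedSpace E G] [Group G]
  [CompleteSpace E] [LieGroup 𝓘(ℝ, E) ∞ G]
  {N H : Subgroup G} [ChartedSpace EN N] [ChartedSpace EH H]
  {𝔫 : LieIdeal ℝ (GroupLieAlgebra 𝓘(ℝ, E) G)}

omit [CompleteSpace E] [LieGroup 𝓘(ℝ, E) ∞ G] in
/-- A linear functional on a subspace of a finite-dimensional normed space extends to a continuous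
linear functional. -/
theorem exists_continuous_extend [FiniteDimensional ℝ E] (p : Submodule ℝ (GroupLieAlgebra 𝓘(ℝ, E) G))
    (ξ : Module.Dual ℝ p) : ∃ ℓ : E →L[ℝ] ℝ, ∀ x : p, ℓ (x : GroupLieAlgebra 𝓘(ℝ, E) G) = ξ x := by
  obtain ⟨g, hg⟩ := LinearMap.exists_extend ξ
  let g' : E →ₗ[ℝ] ℝ := g
  exact ⟨LinearMap.toContinuousLinearMap g', fun x => LinearMap.congr_fun hg x⟩

/-- Replacing ξ by an extension ℓ removes the restriction to 𝔫, so each coordinate of β_ξ is the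
restriction to H of a function on G. -/
theorem inDualCoords_beta_apply (S : StandingAssumptions (EN := EN) (EH := EH) N H 𝔫) {n : ℕ}
    (X : Module.Basis (Fin n) ℝ 𝔫) (ξ : Module.Dual ℝ 𝔫) {ℓ : E →L[ℝ] ℝ}
    (hℓ : ∀ x : 𝔫, ℓ (x : GroupLieAlgebra 𝓘(ℝ, E) G) = ξ x) (h : H) (j : Fin n) :
    inDualCoords X (beta S ξ) h j = ℓ (Ad E (h : G)⁻¹ (X j : GroupLieAlgebra 𝓘(ℝ, E) G)) := by
  rw [inDualCoords, Module.Basis.equivFun_apply, Module.Basis.dualBasis_repr]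
  exact (hℓ _).symm

variable [FiniteDimensional ℝ E]

theorem contMDiffAt_inDualCoords_beta (S : StandingAssumptions (EN := EN) (EH := EH) N H 𝔫) {n : ℕ}
    (X : Module.Basis (Fin n) ℝ 𝔫) (ξ : Module.Dual ℝ 𝔫) :
    ContMDiffAt 𝓘(ℝ, EH) 𝓘(ℝ, Fin n → ℝ) ∞ (inDualCoords X (beta S ξ)) 1 := by
  obtain ⟨ℓ, hℓ⟩ := exists_continuous_extend 𝔫.toSubmodule ξ
  rw [contMDiffAt_pi_space]
  intro j
  simp only [inDualCoords_beta_apply S X ξ hℓ]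
  exact ContMDiffAt.comp (I' := 𝓘(ℝ, E)) (f := fun x : H => (x : G)) (1 : H)
    (contMDiffAt_apply_Ad_inv ℓ (X j : GroupLieAlgebra 𝓘(ℝ, E) G)) S.embedded_H.contMDiff.contMDiffAt

theorem mfderiv_inDualCoords_beta (S : StandingAssumptions (EN := EN) (EH := EH) N H 𝔫) {n : ℕ}
    (X : Module.Basis (Fin n) ℝ 𝔫) (ξ : Module.Dual ℝ 𝔫) (v : GroupLieAlgebra 𝓘(ℝ, EH) H)
    (j : Fin n) :
    (mfderiv 𝓘(ℝ, EH) 𝓘(ℝ, Fin n → ℝ) (inDualCoords X (beta S ξ)) 1 v : Fin n → ℝ) j =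
      ξ ⟨⁅(X j : GroupLieAlgebra 𝓘(ℝ, E) G), inclusionDeriv E EH H v⁆,
        lie_mem_left ℝ (GroupLieAlgebra 𝓘(ℝ, E) G) 𝔫 _ _ (X j).2⟩ := by
  obtain ⟨ℓ, hℓ⟩ := exists_continuous_extend 𝔫.toSubmodule ξ
  have hβ : MDifferentiableAt 𝓘(ℝ, EH) 𝓘(ℝ, Fin n → ℝ) (inDualCoords X (beta S ξ)) (1 : H) :=
    (contMDiffAt_inDualCoords_beta S X ξ).mdifferentiableAt (by simp)
  let π : (Fin n → ℝ) →L[ℝ] ℝ := ContinuousLinearMap.proj j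
  have hπ : MDifferentiableAt 𝓘(ℝ, Fin n → ℝ) 𝓘(ℝ, ℝ) π (inDualCoords X (beta S ξ) (1 : H)) :=
    π.differentiableAt.mdifferentiableAt
  have hι : MDifferentiableAt 𝓘(ℝ, EH) 𝓘(ℝ, E) (fun x : H => (x : G)) 1 :=
    S.embedded_H.contMDiff.contMDiffAt.mdifferentiableAt (by simp)
  have hA : MDifferentiableAt 𝓘(ℝ, E) 𝓘(ℝ, ℝ)
      (fun g : G => ℓ (Ad E g⁻¹ (X j : GroupLieAlgebra 𝓘(ℝ, E) G))) ((1 : H) : G) :=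
    (contMDiffAt_apply_Ad_inv ℓ _).mdifferentiableAt (by simp)
  have h1 := mfderiv_comp (1 : H) hπ hβ
  have h2 := mfderiv_comp (1 : H) hA hι
  have h3 : π ∘ inDualCoords X (beta S ξ) =
      (fun g : G => ℓ (Ad E g⁻¹ (X j : GroupLieAlgebra 𝓘(ℝ, E) G))) ∘ fun x : H => (x : G) :=
    funext fun h => inDualCoords_beta_apply S X ξ hℓ h j
  rw [h3] at h1
  have h4 := ContinuousLinearMap.ext_iff.1 (h1.symm.trans h2) v
  rw [ContinuousLinearMap.mfderiv_eq] at h4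
  exact h4.trans ((mfderiv_apply_Ad_inv_eq_bracket ℓ _ _).trans (hℓ ⟨_, _⟩))

variable {n r : ℕ} (S : StandingAssumptions (EN := EN) (EH := EH) N H 𝔫)
  (X : Module.Basis (Fin n) ℝ 𝔫) (A : Module.Basis (Fin r) ℝ (subgroupLieAlgebra E EH H))

theorem mfderiv_inDualCoords_beta_eq_mulVec (ξ : Module.Dual ℝ 𝔫) {c : Fin r → ℝ}
    {v : GroupLieAlgebra 𝓘(ℝ, EH) H}
    (hv : inclusionDeriv E EH H v = A.equivFun.symm c) :
    (mfderiv 𝓘(ℝ, EH) 𝓘(ℝ, Fin n → ℝ) (inDualCoords X (beta S ξ)) 1 v : Fin n → ℝ) =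
      (D X A ξ).mulVec c := by
  refine funext fun j => ?_
  rw [mfderiv_inDualCoords_beta, Matrix.mulVec, dotProduct]
  -- Packaging a ↦ ξ([X_j, a]) as a linear map lets it pass through the expansion in the basis A.
  let f : GroupLieAlgebra 𝓘(ℝ, E) G →ₗ[ℝ] ℝ :=
    { toFun := fun a => ξ ⟨⁅(X j : GroupLieAlgebra 𝓘(ℝ, E) G), a⁆,
        lie_mem_left ℝ (GroupLieAlgebra 𝓘(ℝ, E) G) 𝔫 _ _ (X j).2⟩
      map_add' := fun a b => by
        rw [← map_add]
        exact congrArg ξ (Subtype.ext (lie_add _ _ _))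
      map_smul' := fun t a => by
        rw [RingHom.id_apply, ← map_smul]
        exact congrArg ξ (Subtype.ext (lie_smul _ _ _)) }
  change f (inclusionDeriv E EH H v) = _
  rw [hv, Module.Basis.equivFun_symm_apply, Submodule.coe_sum, map_sum]
  refine Finset.sum_congr rfl fun k _ => ?_
  rw [Submodule.coe_smul, map_smul, smul_eq_mul, mul_comm]
  rfl

theorem isImmersionAtPoint_beta_iff [LieGroup 𝓘(ℝ, EH) ∞ H] (ξ : Module.Dual ℝ 𝔫) :
    IsImmersionAtPoint (E := EH) X (beta S ξ) (1 : H) ↔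
      ((D X A ξ).transpose * D X A ξ).det ≠ 0 := by
  rw [← injective_mulVec_iff_det_transpose_mul_self_ne_zero, IsImmersionAtPoint,
    and_iff_right (contMDiffAt_inDualCoords_beta S X ξ)]
  have hinj : Function.Injective (inclusionDeriv E EH H) :=
    (S.embedded_H.isImmersion.isImmersionAt 1).mfderiv_injective
      (S.embedded_H.contMDiff.contMDiffAt.mdifferentiableAt (by simp))
  constructor
  · intro h c d hcd
    -- 𝔥 is by definition the range of the differential of H → G, so every coordinate vector lifts
    -- to a tangent vector of H.
    obtain ⟨v, hv⟩ := (A.equivFun.symm c).2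
    obtain ⟨w, hw⟩ := (A.equivFun.symm d).2
    have hvw : v = w := h ((mfderiv_inDualCoords_beta_eq_mulVec S X A ξ hv).trans
      (hcd.trans (mfderiv_inDualCoords_beta_eq_mulVec S X A ξ hw).symm))
    exact A.equivFun.symm.injective (Subtype.ext (hv.symm.trans ((congrArg _ hvw).trans hw)))
  · intro h v w hvw
    -- Conversely, each tangent vector of H has coordinates in A, and `hinj` recovers it from them.
    have key (u : GroupLieAlgebra 𝓘(ℝ, EH) H) :
        inclusionDeriv E EH H u = A.equivFun.symm (A.equivFun ⟨inclusionDeriv E EH H u, u, rfl⟩) := by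
      rw [LinearEquiv.symm_apply_apply]
    have h1 := h ((mfderiv_inDualCoords_beta_eq_mulVec S X A ξ (key v)).symm.trans
      (hvw.trans (mfderiv_inDualCoords_beta_eq_mulVec S X A ξ (key w))))
    exact hinj (congrArg Subtype.val (A.equivFun.injective h1))

omit [FiniteDimensional ℝ E] in
theorem isPolynomialFunction_det_D :
    IsPolynomialFunction fun ξ : Module.Dual ℝ 𝔫 => ((D X A ξ).transpose * D X A ξ).det := by
  refine isPolynomialFunction_det fun i k => ?_
  have : (fun ξ : Module.Dual ℝ 𝔫 => ((D X A ξ).transpose * D X A ξ) i k) =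
      ∑ j, (fun ξ => D X A ξ j i) * fun ξ => D X A ξ j k := by
    ext ξ
    simp [Matrix.mul_apply]
  rw [this]
  -- Each entry of D is evaluation of ξ at a fixed bracket, an element of the double dual of 𝔫.
  exact sum_mem fun j _ => mul_mem (isPolynomialFunction_dual (Module.Dual.eval ℝ 𝔫 _))
    (isPolynomialFunction_dual (Module.Dual.eval ℝ 𝔫 _))

end Beta

end CoadjointImmersion

end

open CoadjointImmersion in
theorem mainTheorem8
    {E EN EH : Type*} [NormedAddCommGroup E] [NormedSpace ℝ E] [FiniteDimensional ℝ E]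
    [CompleteSpace E]
    [NormedAddCommGroup EN] [NormedSpace ℝ EN] [FiniteDimensional ℝ EN]
    [NormedAddCommGroup EH] [NormedSpace ℝ EH] [FiniteDimensional ℝ EH]
    {G : Type*} [TopologicalSpace G] [ChartedSpace E G] [Group G] [LieGroup 𝓘(ℝ, E) ∞ G]
    (N H : Subgroup G)
    [ChartedSpace EN N] [LieGroup 𝓘(ℝ, EN) ∞ N]
    [ChartedSpace EH H] [LieGroup 𝓘(ℝ, EH) ∞ H]
    (𝔫 : LieIdeal ℝ (GroupLieAlgebra 𝓘(ℝ, E) G))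
    (S : StandingAssumptions (EN := EN) (EH := EH) N H 𝔫)
    {n r : ℕ} (X : Module.Basis (Fin n) ℝ 𝔫)
    (A : Module.Basis (Fin r) ℝ (subgroupLieAlgebra E EH H)) :
    -- `D(ξ)` is the Jacobian of `β_ξ` at the identity
    (∀ (ξ : Module.Dual ℝ 𝔫) (k : Fin r) (v : GroupLieAlgebra 𝓘(ℝ, EH) H),
      inclusionDeriv E EH H v = A k →
        mfderiv 𝓘(ℝ, EH) 𝓘(ℝ, Fin n → ℝ) (inDualCoords X (beta S ξ)) (1 : H) v =
          fun j => D X A ξ j k) ∧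
    IsPolynomialFunction (fun ξ : Module.Dual ℝ 𝔫 => ((D X A ξ).transpose * D X A ξ).det) ∧
    {ξ : Module.Dual ℝ 𝔫 | IsImmersionAtPoint (E := EH) X (beta S ξ) (1 : H)} =
      {ξ : Module.Dual ℝ 𝔫 | ((D X A ξ).transpose * D X A ξ).det = 0}ᶜ ∧
    IsZariskiOpen {ξ : Module.Dual ℝ 𝔫 | IsImmersionAtPoint (E := EH) X (beta S ξ) (1 : H)} := by
  have himm : {ξ : Module.Dual ℝ 𝔫 | IsImmersionAtPoint (E := EH) X (beta S ξ) (1 : H)} =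
      {ξ : Module.Dual ℝ 𝔫 | ((D X A ξ).transpose * D X A ξ).det = 0}ᶜ :=
    Set.ext fun ξ => isImmersionAtPoint_beta_iff S X A ξ
  refine ⟨fun ξ k v hv => ?_, isPolynomialFunction_det_D X A, himm, ?_⟩
  · refine funext fun j => ?_
    refine (mfderiv_inDualCoords_beta S X ξ v j).trans ?_
    exact congrArg ξ (Subtype.ext (congrArg
      (fun a : GroupLieAlgebra 𝓘(ℝ, E) G => ⁅(X j : GroupLieAlgebra 𝓘(ℝ, E) G), a⁆) hv))
  · refine ⟨{fun ξ => ((D X A ξ).transpose * D X A ξ).det}, ?_, ?_⟩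
    · rintro f rfl
      exact isPolynomialFunction_det_D X A
    · rw [himm]
      simp
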